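/- Let $N=\{1,2,3,\dots\}$ and let $\beta N$ be the set of all ultrafilters on $N$, with the multiplication given by $$A\in p\cdot q\iff\{n\in N: A/n\in q\}\in p,\qquad A/n=\{m\in N: nm\in A\},$$ where $n\in N$ is identified with the principal ultrafilter $\{A\subseteq N:n\in A\}$. For $p,q\in\beta N$ write $p\mid_L q$ if $q=rp$ for some $r\in\beta N$, and call $p$ right cancelable if, for all $x,y\in\beta N$, $xp=yp$ implies $x=y$. **Lemma.** There is an infinite sequence $p_0,p_1,p_2,\dots$ of right cancelable elements of $\beta N$ which is strictly $\mid_L$-descending, that is, $p_n\mid_L p_m$ and $p_m\nmid_L p_n$ whenever $m<n$, and which satisfies $p_n=2p_{n+1}$ for all $n\ge 0$. -/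

import Mathlib

-- The product of ultrafilters on a semigroup (here always the multiplicative semigroup `ℕ+`).
attribute [local instance] Ultrafilter.mul

/-- The Stone–Čech compactification `βN` of the discrete space `N = {1, 2, 3, …}`,
realized as the space of ultrafilters on `ℕ+`. -/
abbrev BetaN : Type := Ultrafilter ℕ+

namespace BetaN

/-- The multiplication of `βN` is the usual one: `A ∈ p * q` iff `{n | A / n ∈ q} ∈ p`, where
`A / n = {a / n | a ∈ A, n ∣ a} = {m | n * m ∈ A}`. -/
theorem mem_mul_iff (p q : BetaN) (A : Set ℕ+) :
    A ∈ p * q ↔ {n : ℕ+ | {m : ℕ+ | n * m ∈ A} ∈ q} ∈ p :=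
  Iff.rfl

/-- The principal ultrafilter of `n`, by which `N` is regarded as a subset of `βN`. -/
def ofPNat (n : ℕ+) : BetaN := pure n

/-- `p ∣_L q`: there is `r ∈ βN` with `q = r p`. -/
def LeftDvd (p q : BetaN) : Prop := ∃ r : BetaN, q = r * p

/-- `p` is right cancelable: `x p = y p` implies `x = y`, for all `x, y ∈ βN`. -/
def RightCancelable (p : BetaN) : Prop := ∀ x y : BetaN, x * p = y * p → x = y

/-- `p 0, p 1, …` is strictly `∣_L`-descending: for `m < n`, `p n` lies strictly below `p m`
in the preorder `∣_L`. -/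
def StrictlyLeftDescending (p : ℕ → BetaN) : Prop :=
  ∀ m n : ℕ, m < n → LeftDvd (p n) (p m) ∧ ¬ LeftDvd (p m) (p n)

end BetaN

/-!
Let `p n` be the limit of `2 ^ (j ^ 2 - n)` as `j` tends to infinity along a fixed nonprincipal
ultrafilter on `ℕ`. For `j ≥ n + 1` the exponents for `n` and `n + 1` differ by one, whence
`p n = 2 * p (n + 1)`.

Right cancelability comes from sparseness. By `rightCancelable_map`, the limit of a family `a`
along `U` is right cancelable once each `n : ℕ+` has a `U`-large index set `g n` for which the sets
`{n * a i | i ∈ g n}` are pairwise disjoint: membership in a union of such sets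
recovers from `x * p` which sets belong to `x`. The family `2 ^ (j ^ 2 - c)` qualifies with
`g n = {j | n ≤ j ∧ c ≤ j}`, because the gap `(j + 1) ^ 2 - j ^ 2` exceeds `j`, so that the factor
`2 ^ (i ^ 2 - j ^ 2)` is too large to be absorbed by a number `n ≤ j` (`eq_of_mul_two_pow_sq_eq`).

Strictness then follows: if `p n = r * p m` with `m < n`, then `p n = (r * 2 ^ (n - m)) * p n`, and
cancelling `p n` makes `r * 2 ^ (n - m)` equal to `1`, whereas no number `a * 2 ^ (n - m)` is `1`.
-/

namespace BetaN

theorem mul_assoc' (p q r : BetaN) : p * q * r = p * (q * r) :=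
  @mul_assoc _ Ultrafilter.semigroup p q r

theorem mem_ofPNat_mul (k : ℕ+) (p : BetaN) (A : Set ℕ+) :
    A ∈ ofPNat k * p ↔ {m : ℕ+ | k * m ∈ A} ∈ p :=
  Iff.rfl

/-- A limit along `U` is right cancelable if the translates by all `n` of suitable `U`-large
portions of the family are pairwise disjoint. -/
theorem rightCancelable_map {ι : Type*} (U : Ultrafilter ι) (a : ι → ℕ+) (g : ℕ+ → Set ι)
    (hg : ∀ n, g n ∈ U)
    (ha : ∀ n m i j, i ∈ g n → j ∈ g m → n * a i = m * a j → n = m) :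
    RightCancelable (U.map a) := by
  intro x y hxy
  symm
  refine Ultrafilter.eq_of_le fun s hs ↦ ?_
  -- The set `B` is the union over `n ∈ s` of the disjoint sets; it lies in `x * p` iff `s ∈ x`.
  let B : Set ℕ+ := {t | ∃ n ∈ s, ∃ i ∈ g n, t = n * a i}
  have hB : B ∈ x * U.map a := by
    rw [mem_mul_iff]
    filter_upwards [hs] with n hn
    rw [Ultrafilter.mem_map]
    filter_upwards [hg n] with i hi
    exact ⟨n, hn, i, hi, rfl⟩
  rw [hxy, mem_mul_iff] at hB
  refine Filter.mem_of_superset hB fun n hn ↦ ?_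
  obtain ⟨i, hi, hig⟩ := U.nonempty_of_mem (Filter.inter_mem (Ultrafilter.mem_map.1 hn) (hg n))
  obtain ⟨m, hm, j, hj, h⟩ := hi
  exact ha n m i j hig hj h ▸ hm

theorem ofPNat_mul_map {ι : Type*} (U : Ultrafilter ι) (k : ℕ+) (a b : ι → ℕ+)
    (h : ∀ᶠ i in U, k * a i = b i) : U.map b = ofPNat k * U.map a := by
  symm
  refine Ultrafilter.eq_of_le fun s hs ↦ ?_
  change {m : ℕ+ | k * m ∈ s} ∈ U.map a
  rw [Ultrafilter.mem_map]
  filter_upwards [h, Ultrafilter.mem_map.1 hs] with i hi his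
  change k * a i ∈ s
  rwa [hi]

theorem mul_ofPNat_ne_one (r : BetaN) {k : ℕ+} (hk : k ≠ 1) : r * ofPNat k ≠ ofPNat 1 := by
  intro h
  have h1 : ({1} : Set ℕ+) ∈ r * ofPNat k := by
    rw [h]
    exact Set.mem_singleton _
  obtain ⟨n, hn⟩ := r.nonempty_of_mem ((mem_mul_iff _ _ _).1 h1)
  have hn : n * k = 1 := hn
  exact hk (PNat.eq (Nat.eq_one_of_mul_eq_one_left (congrArg PNat.val hn)))

theorem ofPNat_one_mul (p : BetaN) : ofPNat 1 * p = p := by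
  refine Ultrafilter.ext fun s ↦ ?_
  simp [mem_ofPNat_mul]

theorem ofPNat_mul_ofPNat (k l : ℕ+) : ofPNat k * ofPNat l = ofPNat (k * l) :=
  Ultrafilter.ext fun _ ↦ Iff.rfl

/-- A proper multiple of a right cancelable `p` by an element of `N` does not left divide `p`. -/
theorem RightCancelable.not_leftDvd_ofPNat_mul {p : BetaN} (hp : RightCancelable p) {k : ℕ+}
    (hk : k ≠ 1) : ¬ LeftDvd (ofPNat k * p) p := by
  rintro ⟨r, hr⟩
  refine mul_ofPNat_ne_one r hk (hp _ _ ?_)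
  rw [mul_assoc', ← hr, ofPNat_one_mul]

theorem eq_ofPNat_two_pow_mul {p : ℕ → BetaN} (h : ∀ n, p n = ofPNat 2 * p (n + 1)) (m k : ℕ) :
    p m = ofPNat (2 ^ k) * p (m + k) := by
  induction k with
  | zero => simp [ofPNat_one_mul]
  | succ k ih => rw [ih, h, ← mul_assoc', ofPNat_mul_ofPNat, pow_succ, add_assoc]

theorem not_mul_two_pow_sq_eq {n m i j : ℕ} (hm : 0 < m) (hn : n ≤ i) (hij : i < j) :
    n * 2 ^ (i ^ 2) ≠ m * 2 ^ (j ^ 2) := by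
  refine ne_of_lt ?_
  calc n * 2 ^ (i ^ 2) < 2 ^ i * 2 ^ (i ^ 2) := by
        gcongr
        exact hn.trans_lt Nat.lt_two_pow_self
    _ = 2 ^ (i + i ^ 2) := (pow_add _ _ _).symm
    _ ≤ 2 ^ (j ^ 2) := by
        gcongr
        · norm_num
        · nlinarith
    _ ≤ m * 2 ^ (j ^ 2) := Nat.le_mul_of_pos_left _ hm

theorem eq_of_mul_two_pow_sq_eq {n m i j : ℕ} (hn0 : 0 < n) (hm0 : 0 < m) (hn : n ≤ i)
    (hm : m ≤ j) (h : n * 2 ^ (i ^ 2) = m * 2 ^ (j ^ 2)) : n = m := by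
  rcases lt_trichotomy i j with hij | rfl | hij
  · exact absurd h (not_mul_two_pow_sq_eq hm0 hn hij)
  · exact Nat.eq_of_mul_eq_mul_right (by positivity) h
  · exact absurd h.symm (not_mul_two_pow_sq_eq hn0 hm hij)

/-- The limit of `2 ^ (j ^ 2 - c)` along a nonprincipal ultrafilter. The subtraction is truncated,
which affects only finitely many `j`. -/
noncomputable def sparseLimit (c : ℕ) : BetaN :=
  (Filter.hyperfilter ℕ).map fun j ↦ (2 : ℕ+) ^ (j ^ 2 - c)

theorem eventually_ge_hyperfilter (c : ℕ) : ∀ᶠ j in (Filter.hyperfilter ℕ : Filter ℕ), c ≤ j :=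
  (Filter.eventually_ge_atTop c).filter_mono Nat.hyperfilter_le_atTop

theorem sparseLimit_eq_two_mul (c : ℕ) : sparseLimit c = ofPNat 2 * sparseLimit (c + 1) := by
  refine ofPNat_mul_map _ _ _ _ ?_
  filter_upwards [eventually_ge_hyperfilter (c + 1)] with j hj
  have : j ^ 2 - c = (j ^ 2 - (c + 1)) + 1 := by
    have : j ≤ j ^ 2 := Nat.le_self_pow two_ne_zero j
    omega
  rw [this, pow_succ' 2 (j ^ 2 - (c + 1))]

theorem rightCancelable_sparseLimit (c : ℕ) : RightCancelable (sparseLimit c) := by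
  refine rightCancelable_map _ _ (fun n ↦ {j | (n : ℕ) ≤ j ∧ c ≤ j})
    (fun n ↦ (eventually_ge_hyperfilter n).and (eventually_ge_hyperfilter c)) ?_
  rintro n m i j ⟨hni, hci⟩ ⟨hmj, hcj⟩ h
  have restore (i : ℕ) (hi : c ≤ i) : 2 ^ (i ^ 2 - c) * 2 ^ c = 2 ^ (i ^ 2) := by
    rw [← pow_add, Nat.sub_add_cancel (hi.trans (Nat.le_self_pow two_ne_zero i))]
  have h' : (n : ℕ) * 2 ^ (i ^ 2 - c) = m * 2 ^ (j ^ 2 - c) := by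
    simpa using congrArg PNat.val h
  refine PNat.eq (eq_of_mul_two_pow_sq_eq n.pos m.pos hni hmj ?_)
  rw [← restore i hci, ← restore j hcj, ← mul_assoc, ← mul_assoc, h']

end BetaN

theorem mainTheorem4 :
    ∃ p : ℕ → BetaN,
      (∀ n : ℕ, BetaN.RightCancelable (p n)) ∧
      BetaN.StrictlyLeftDescending p ∧
      (∀ n : ℕ, p n = BetaN.ofPNat 2 * p (n + 1)) := by
  refine ⟨BetaN.sparseLimit, BetaN.rightCancelable_sparseLimit, fun m n hmn ↦ ?_,
    BetaN.sparseLimit_eq_two_mul⟩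
  obtain ⟨k, hk, rfl⟩ := exists_pos_add_of_lt hmn
  have h := BetaN.eq_ofPNat_two_pow_mul BetaN.sparseLimit_eq_two_mul m k
  refine ⟨⟨_, h⟩, ?_⟩
  rw [h]
  refine (BetaN.rightCancelable_sparseLimit _).not_leftDvd_ofPNat_mul fun h2 ↦ ?_
  have h2 : (2 : ℕ) ^ k = 1 := by simpa using congrArg PNat.val h2
  exact (Nat.one_lt_two_pow hk.ne').ne' h2
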